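/- Let $\{J_n\}_{n\ge 1}$ be i.i.d. $\mathbb{Z}$-valued random variables on a probability space, and let $S_0=0$ and $S_n=J_1+\dots+J_n$ be the associated random walk on $\mathbb{Z}$. Suppose that the walk is symmetric, i.e. $\{S_n\}_{n\ge 0}$ and $\{-S_n\}_{n\ge 0}$ have the same finite-dimensional distributions, and that $p_n:=\mathbb{P}(J_1=n)>0$ for all $n\ge 1$. If $$\sum_{n=1}^{\infty}\frac{1}{n^{3}p_n}<\infty,$$ then $\{S_n\}_{n\ge 0}$ is transient: $\mathbb{P}\left(\lim_{n\to\infty}|S_n|=\infty\right)=1$, and every state $u\in\mathbb{Z}$ is transient for the walk as a Markov chain, i.e. $\sum_{n=1}^{\infty}\mathbb{P}(u+S_n=u)<\infty$. -/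

import Mathlib

open MeasureTheory ProbabilityTheory Filter

namespace RW

/-- The walk `S_n = J_1 + ⋯ + J_n` (so `S_0 = 0`) with jumps `J_1, J_2, …`; the jump `J_{i+1}` is
written `J i`. -/
def walk {Ω : Type*} (J : ℕ → Ω → ℤ) (n : ℕ) (ω : Ω) : ℤ :=
  ∑ i ∈ Finset.range n, J i ω

/-- The jumps `J 0, J 1, …` are independent, identically distributed integer random variables. -/
structure IsIIDJumps {Ω : Type*} [MeasurableSpace Ω] (μ : Measure Ω) (J : ℕ → Ω → ℤ) : Prop where
  measurable : ∀ i, Measurable (J i)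
  indep : iIndepFun J μ
  identDistrib : ∀ i, IdentDistrib (J i) (J 0) μ μ

/-- A process is symmetric if `X` and `-X` have the same finite-dimensional distributions. -/
def IsSymmetricProcess {Ω : Type*} [MeasurableSpace Ω] (μ : Measure Ω) (X : ℕ → Ω → ℤ) : Prop :=
  ∀ I : Finset ℕ,
    IdentDistrib (fun ω (i : I) => X i ω) (fun ω (i : I) => -X i ω) μ μ

/-- Transience of a process on `ℤ`: almost surely `|X_n| → ∞`. -/
def IsTransient {Ω : Type*} [MeasurableSpace Ω] (μ : Measure Ω) (X : ℕ → Ω → ℤ) : Prop :=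
  ∀ᵐ ω ∂μ, Tendsto (fun n => |X n ω|) atTop atTop

/-- Transience in the Markov chain sense: every state `u` is transient, i.e. the expected number
of returns to `u` of the chain `u + X_n` started at `u` is finite (here `X_0 = 0`). -/
def AllStatesTransient {Ω : Type*} [MeasurableSpace Ω] (μ : Measure Ω) (X : ℕ → Ω → ℤ) : Prop :=
  ∀ u : ℤ, ∑' n : ℕ, μ {ω | u + X (n + 1) ω = u} < ⊤

end RW

namespace RW

/-! The expected number of visits to `u` is controlled by Fourier inversion: if φ is the
characteristic function of a jump, real by symmetry, then 2π P(S_n = u) = ∫ cos(tu) φ(t)^n dt over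
(-π, π], so it suffices to dominate the partial sums of Σ φ^n by an integrable function. As they are
at most 2/(1-φ), a lower bound on 1-φ is needed. Keeping only jumps n ≤ N = ⌊π/|t|⌋ gives 1-φ ≳ t² Σ
p_n n² (`mul_sum_le_one_sub_integral_cos`), and Cauchy-Schwarz turns this into 1/(1-φ) ≲ t⁴ Σ
n²/p_n. The n-th term lives on |t| ≤ π/n and has integral of order 1/(n³ p_n), which is summable.
Borel-Cantelli then gives escape to infinity. -/

/-! ### Characteristic functions and Fourier inversion -/

open Complex in
/-- The characteristic function of a symmetric integer random variable is real. -/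
lemma charFun_eq_ofReal_of_symm {Ω : Type*} [MeasurableSpace Ω] {μ : Measure Ω}
    {X : Ω → ℤ} (hsymm : IdentDistrib X (fun ω => -X ω) μ μ) (t : ℝ) :
    charFun (μ.map fun ω => (X ω : ℝ)) t =
      ((charFun (μ.map fun ω => (X ω : ℝ)) t).re : ℂ) := by
  have hX : AEMeasurable (fun ω => (X ω : ℝ)) μ :=
    (measurable_from_top (f := fun k : ℤ => (k : ℝ))).comp_aemeasurable hsymm.aemeasurable_fst
  have h1 := (hsymm.comp (u := fun k : ℤ => (k : ℝ)) measurable_from_top).map_eq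
  have h2 : (μ.map ((fun k : ℤ => (k : ℝ)) ∘ fun ω => -X ω)) = μ.map (fun ω => -1 * (X ω : ℝ)) := by
    congr 1; ext ω; simp
  have h3 := charFun_map_mul_comp hX (-1) t
  rw [← h2, ← h1, neg_one_mul, charFun_neg] at h3
  exact (conj_eq_iff_re.mp h3.symm).symm

/-- The real part of the characteristic function is the mean cosine. -/
lemma charFun_map_re {Ω : Type*} [MeasurableSpace Ω] {μ : Measure Ω} [IsProbabilityMeasure μ]
    {X : Ω → ℤ} (hX : Measurable X) (t : ℝ) :
    (charFun (μ.map fun ω => (X ω : ℝ)) t).re = ∫ ω, Real.cos (t * X ω) ∂μ := by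
  have hm : Measurable fun ω => (X ω : ℝ) := (measurable_from_top (f := fun k : ℤ => (k : ℝ))).comp hX
  rw [charFun_apply_real, integral_map hm.aemeasurable (by fun_prop)]
  have hi : Integrable (fun ω => Complex.exp (t * ((X ω : ℝ) : ℂ) * Complex.I)) μ := by
    refine Integrable.of_bound (C := 1) (by fun_prop) (ae_of_all _ fun ω => ?_)
    rw [← Complex.ofReal_mul, Complex.norm_exp_ofReal_mul_I]
  rw [← RCLike.re_eq_complex_re, ← integral_re hi]
  refine integral_congr_ae (ae_of_all _ fun ω => ?_)
  simp only [RCLike.re_eq_complex_re]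
  rw [← Complex.ofReal_mul, Complex.exp_ofReal_mul_I_re]

/-- The mean of the shifted cosine along a walk with symmetric independent steps. -/
lemma integral_cos_walk {Ω : Type*} [MeasurableSpace Ω] {μ : Measure Ω} [IsProbabilityMeasure μ]
    {J : ℕ → Ω → ℤ} (hJ : IsIIDJumps μ J) (hsymm : IdentDistrib (J 0) (fun ω => -J 0 ω) μ μ)
    (n : ℕ) (u : ℤ) (t : ℝ) :
    ∫ ω, Real.cos (t * (walk J n ω - u : ℤ)) ∂μ =
      Real.cos (t * u) * (∫ ω, Real.cos (t * J 0 ω) ∂μ) ^ n := by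
  have hc : Measurable (fun k : ℤ => (k : ℝ)) := measurable_from_top
  have hW : Measurable (walk J n) := by
    unfold walk
    exact Finset.measurable_sum _ fun i _ => hJ.measurable i
  have hind : iIndepFun (fun i ω => (J i ω : ℝ)) μ :=
    hJ.indep.comp (fun _ (k : ℤ) => (k : ℝ)) fun _ => hc
  have hwalk : charFun (μ.map fun ω => (walk J n ω : ℝ)) t =
      (((∫ ω, Real.cos (t * J 0 ω) ∂μ) ^ n : ℝ) : ℂ) := by
    have h := (hind.restrict (Finset.range n)).charFun_map_fun_finsetSum_eq_prod
      (X := fun i ω => (J i ω : ℝ)) (s := Finset.range n)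
      (fun i _ => (hc.comp (hJ.measurable i)).aemeasurable)
    have hid : ∀ i, charFun (μ.map fun ω => (J i ω : ℝ)) = charFun (μ.map fun ω => (J 0 ω : ℝ)) :=
      fun i => congrArg _ ((hJ.identDistrib i).comp hc).map_eq
    have h0 := charFun_eq_ofReal_of_symm hsymm t
    rw [charFun_map_re (hJ.measurable 0)] at h0
    simp only [walk, Int.cast_sum]
    rw [h]
    simp only [hid, Finset.prod_const, Finset.card_range, Pi.pow_apply]
    rw [h0]
    norm_cast
  have hm : Measurable fun ω => (walk J n ω : ℝ) := hc.comp hW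
  have hi : Integrable (fun ω => Complex.exp (t * ((walk J n ω : ℝ) : ℂ) * Complex.I)) μ := by
    refine Integrable.of_bound (C := 1) (by fun_prop) (ae_of_all _ fun ω => ?_)
    rw [← Complex.ofReal_mul, Complex.norm_exp_ofReal_mul_I]
  rw [charFun_apply_real, integral_map hm.aemeasurable (by fun_prop)] at hwalk
  -- Shifting by `u` multiplies by a phase; as the characteristic function is real, only the cosine
  -- of that phase survives in the real part.
  have h4 : ∫ ω, Complex.exp (((-(t * u) : ℝ) : ℂ) * Complex.I) *
        Complex.exp (t * ((walk J n ω : ℝ) : ℂ) * Complex.I) ∂μ =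
      Complex.exp (((-(t * u) : ℝ) : ℂ) * Complex.I) *
        (((∫ ω, Real.cos (t * J 0 ω) ∂μ) ^ n : ℝ) : ℂ) := by
    rw [integral_const_mul, hwalk]
  have h5 := congrArg Complex.re h4
  rw [Complex.re_mul_ofReal, Complex.exp_ofReal_mul_I_re, Real.cos_neg,
    ← RCLike.re_eq_complex_re, ← integral_re (hi.const_mul _)] at h5
  rw [← h5]
  refine integral_congr_ae (ae_of_all _ fun ω => ?_)
  simp only [RCLike.re_eq_complex_re]
  rw [← Complex.exp_add, ← Complex.ofReal_mul, ← add_mul, ← Complex.ofReal_add,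
    Complex.exp_ofReal_mul_I_re]
  push_cast
  ring_nf

lemma integral_cos_mul_int (k : ℤ) :
    ∫ t in Set.Ioc (-Real.pi) Real.pi, Real.cos (t * k) = if k = 0 then 2 * Real.pi else 0 := by
  rw [← intervalIntegral.integral_of_le (by linarith [Real.pi_pos])]
  split_ifs with h
  · simp [h]; ring
  · have hk : (k : ℝ) ≠ 0 := by exact_mod_cast h
    rw [intervalIntegral.integral_comp_mul_right _ hk, integral_cos]
    have := Real.sin_int_mul_pi k
    rw [neg_mul, Real.sin_neg, mul_comm Real.pi, this]
    simp

/-- Fourier inversion for the law of an integer random variable. -/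
lemma two_pi_mul_measureReal_eq {Ω : Type*} [MeasurableSpace Ω] {μ : Measure Ω}
    [IsProbabilityMeasure μ] {X : Ω → ℤ} (hX : Measurable X) :
    2 * Real.pi * μ.real {ω | X ω = 0} =
      ∫ t in Set.Ioc (-Real.pi) Real.pi, ∫ ω, Real.cos (t * X ω) ∂μ := by
  have hm : Measurable fun ω => (X ω : ℝ) := (measurable_from_top (f := fun k : ℤ => (k : ℝ))).comp hX
  rw [integral_integral_swap]
  · simp only [integral_cos_mul_int]
    have : (fun ω => if X ω = 0 then 2 * Real.pi else 0) =
        Set.indicator {ω | X ω = 0} fun _ => 2 * Real.pi := by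
      ext ω; simp [Set.indicator]
    have hset : MeasurableSet {ω | X ω = 0} := hX (measurableSet_singleton 0)
    rw [this, integral_indicator_const _ hset, smul_eq_mul, mul_comm]
  · refine Integrable.of_bound (C := 1) ?_ (ae_of_all _ fun x => ?_)
    · refine Measurable.aestronglyMeasurable ?_
      exact Real.measurable_cos.comp (measurable_fst.mul (hm.comp measurable_snd))
    · exact Real.abs_cos_le_one _

/-! ### Lower bound on the spectral gap -/

/-- The spectral gap is bounded below through the probabilities of the points `1, …, N`. -/
lemma mul_sum_le_one_sub_integral_cos {Ω : Type*} [MeasurableSpace Ω] {μ : Measure Ω}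
    [IsProbabilityMeasure μ] {X : Ω → ℤ} (hX : Measurable X) {t : ℝ} {N : ℕ}
    (hN : N * |t| ≤ Real.pi) :
    2 / Real.pi ^ 2 * t ^ 2 * ∑ n ∈ Finset.range N,
        μ.real {ω | X ω = ((n + 1 : ℕ) : ℤ)} * ((n + 1 : ℕ) : ℝ) ^ 2 ≤
      1 - ∫ ω, Real.cos (t * X ω) ∂μ := by
  have hm : Measurable fun ω => (X ω : ℝ) := (measurable_from_top (f := fun k : ℤ => (k : ℝ))).comp hX
  have hcos : Integrable (fun ω => Real.cos (t * X ω)) μ :=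
    Integrable.of_bound (C := 1) (by fun_prop) (ae_of_all _ fun ω => Real.abs_cos_le_one _)
  have hset : ∀ k : ℤ, MeasurableSet {ω | X ω = k} := fun k => hX (measurableSet_singleton k)
  have h1 : ∀ n : ℕ, Integrable (Set.indicator {ω | X ω = ((n + 1 : ℕ) : ℤ)}
      fun _ => 2 / Real.pi ^ 2 * t ^ 2 * ((n + 1 : ℕ) : ℝ) ^ 2) μ := fun n =>
    (integrable_const _).indicator (hset _)
  have h2 : 1 - ∫ ω, Real.cos (t * X ω) ∂μ = ∫ ω, (1 - Real.cos (t * X ω)) ∂μ := by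
    rw [integral_sub (integrable_const _) hcos]; simp
  have h3 : 2 / Real.pi ^ 2 * t ^ 2 * ∑ n ∈ Finset.range N,
        μ.real {ω | X ω = ((n + 1 : ℕ) : ℤ)} * ((n + 1 : ℕ) : ℝ) ^ 2 =
      ∫ ω, ∑ n ∈ Finset.range N, Set.indicator {ω | X ω = ((n + 1 : ℕ) : ℤ)}
        (fun _ => 2 / Real.pi ^ 2 * t ^ 2 * ((n + 1 : ℕ) : ℝ) ^ 2) ω ∂μ := by
    rw [integral_finsetSum _ fun n _ => h1 n, Finset.mul_sum]
    refine Finset.sum_congr rfl fun n _ => ?_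
    rw [integral_indicator_const _ (hset _), smul_eq_mul]
    ring
  rw [h2, h3]
  refine integral_mono (integrable_finsetSum _ fun n _ => h1 n)
    ((integrable_const _).sub hcos) fun ω => ?_
  -- The events are disjoint, so at most one indicator is nonzero; there `hN` puts the angle in [-π,
  -- π], where cos x ≤ 1 - 2x²/π².
  by_cases hω : ∃ n ∈ Finset.range N, X ω = ((n + 1 : ℕ) : ℤ)
  · obtain ⟨n, hn, hXn⟩ := hω
    simp only
    rw [Finset.sum_eq_single_of_mem n hn]
    · rw [Set.indicator_of_mem (by exact hXn), hXn]
      have hb : |t * ((n + 1 : ℕ) : ℝ)| ≤ Real.pi := by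
        rw [abs_mul, Nat.abs_cast, mul_comm]
        refine le_trans ?_ hN
        gcongr
        exact Finset.mem_range.mp hn
      have := Real.cos_le_one_sub_mul_cos_sq hb
      rw [Int.cast_natCast]
      linarith [this, mul_pow t ((n + 1 : ℕ) : ℝ) 2,
        congrArg (2 / Real.pi ^ 2 * ·) (mul_pow t ((n + 1 : ℕ) : ℝ) 2)]
    · intro m _ hmn
      refine Set.indicator_of_notMem (fun h => hmn ?_) _
      have h' : X ω = ((m + 1 : ℕ) : ℤ) := h
      rw [hXn] at h'
      have := Int.ofNat_inj.mp h'
      omega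
  · push Not at hω
    simp only
    rw [Finset.sum_eq_zero fun n hn => Set.indicator_of_notMem (by exact hω n hn) _]
    linarith [Real.cos_le_one (t * X ω)]

lemma cube_le_three_mul_sum_sq (N : ℕ) :
    (N : ℝ) ^ 3 ≤ 3 * ∑ n ∈ Finset.range N, ((n + 1 : ℕ) : ℝ) ^ 2 := by
  induction N with
  | zero => simp
  | succ k ih =>
    rw [Finset.sum_range_succ]
    push_cast at ih ⊢
    nlinarith [(Nat.cast_nonneg k : (0 : ℝ) ≤ k)]

/-- Cauchy-Schwarz for n² = (n√p_n)(n/√p_n), with Σ n² ≥ N³/3. It trades the sum in the gap bound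
for one in 1/p_n. -/
lemma pow_six_le_nine_mul_sum_mul_sum {p : ℕ → ℝ} (hpos : ∀ n : ℕ, 0 < p (n + 1)) (N : ℕ) :
    (N : ℝ) ^ 6 ≤ 9 * ((∑ n ∈ Finset.range N, p (n + 1) * ((n + 1 : ℕ) : ℝ) ^ 2) *
      ∑ n ∈ Finset.range N, ((n + 1 : ℕ) : ℝ) ^ 2 / p (n + 1)) := by
  have h := Finset.sum_sq_le_sum_mul_sum_of_sq_le_mul (Finset.range N)
    (r := fun n => ((n + 1 : ℕ) : ℝ) ^ 2) (f := fun n => p (n + 1) * ((n + 1 : ℕ) : ℝ) ^ 2)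
    (g := fun n => ((n + 1 : ℕ) : ℝ) ^ 2 / p (n + 1))
    (fun n _ => mul_nonneg (hpos n).le (sq_nonneg _))
    (fun n _ => div_nonneg (sq_nonneg _) (hpos n).le)
    (fun n _ => by have := (hpos n).ne'; field_simp; exact le_rfl)
  have h3 := pow_le_pow_left₀ (by positivity) (cube_le_three_mul_sum_sq N) 2
  nlinarith [h, h3]

/-- Pointwise bound for the partial sums of the Green kernel in Fourier variables. -/
lemma abs_sum_pow_integral_cos_le {Ω : Type*} [MeasurableSpace Ω] {μ : Measure Ω}
    [IsProbabilityMeasure μ] {X : Ω → ℤ} (hX : Measurable X) {p : ℕ → ℝ}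
    (hp : ∀ n : ℕ, μ.real {ω | X ω = ((n + 1 : ℕ) : ℤ)} = p (n + 1))
    (hpos : ∀ n : ℕ, 0 < p (n + 1)) {t : ℝ} (ht0 : t ≠ 0) (htpi : |t| ≤ Real.pi) (M : ℕ) :
    |∑ m ∈ Finset.range M, (∫ ω, Real.cos (t * X ω) ∂μ) ^ m| ≤
      ∑ n ∈ Finset.range ⌊Real.pi / |t|⌋₊,
        9 * Real.pi ^ 2 * t ^ 4 * (((n + 1 : ℕ) : ℝ) ^ 2 / p (n + 1)) := by
  have htp : 0 < |t| := abs_pos.mpr ht0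
  set N := ⌊Real.pi / |t|⌋₊ with hNdef
  set φ := ∫ ω, Real.cos (t * X ω) ∂μ with hφ
  have hN : N * |t| ≤ Real.pi := by
    rw [← le_div_iff₀ htp]
    exact Nat.floor_le (by positivity)
  have hN1 : (1 : ℝ) ≤ N := by
    exact_mod_cast Nat.le_floor (by rw [Nat.cast_one, le_div_iff₀ htp]; linarith)
  -- Since N ≥ 1, 2N|t| ≥ (N+1)|t| > π.
  have hNt : 1 ≤ N * |t| := by
    have h := Nat.lt_floor_add_one (Real.pi / |t|)
    rw [div_lt_iff₀ htp, ← hNdef] at h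
    nlinarith [Real.pi_gt_three]
  have hgap := mul_sum_le_one_sub_integral_cos (μ := μ) hX hN
  simp only [hp] at hgap
  rw [← hφ] at hgap
  have hCS := pow_six_le_nine_mul_sum_mul_sum hpos N
  rw [← Finset.mul_sum]
  set A := ∑ n ∈ Finset.range N, p (n + 1) * ((n + 1 : ℕ) : ℝ) ^ 2
  set B := ∑ n ∈ Finset.range N, ((n + 1 : ℕ) : ℝ) ^ 2 / p (n + 1)
  have hB : 0 ≤ B := Finset.sum_nonneg fun n _ => div_nonneg (sq_nonneg _) (hpos n).le
  have hφ1 : |φ| ≤ 1 := by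
    have := norm_integral_le_of_norm_le_const (μ := μ) (f := fun ω => Real.cos (t * X ω)) (C := 1)
      (ae_of_all _ fun ω => Real.abs_cos_le_one _)
    simpa using this
  -- The 2 matches |1 - φ^M| ≤ 2 in the geometric sum; the inequality also rules out φ = 1.
  have hmain : 2 ≤ 9 * Real.pi ^ 2 * t ^ 4 * B * (1 - φ) := by
    have h1 : 1 ≤ (N : ℝ) ^ 6 * t ^ 6 := by
      have := one_le_pow₀ hNt (n := 6)
      rwa [mul_pow, show |t| ^ 6 = t ^ 6 from Even.pow_abs (by decide) t] at this
    have h2 : (N : ℝ) ^ 6 * t ^ 6 ≤ 9 * (A * B) * t ^ 6 :=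
      mul_le_mul_of_nonneg_right hCS (by positivity)
    have h3 := mul_le_mul_of_nonneg_left hgap (show 0 ≤ 9 * Real.pi ^ 2 * t ^ 4 * B by positivity)
    have h4 : 9 * Real.pi ^ 2 * t ^ 4 * B * (2 / Real.pi ^ 2 * t ^ 2 * A) =
        2 * (9 * (A * B) * t ^ 6) := by
      field_simp
    linarith
  have h1φ : 0 < 1 - φ := by
    rcases (sub_nonneg.mpr (abs_le.mp hφ1).2).eq_or_lt with h | h
    · rw [← h] at hmain; linarith
    · exact h
  refine le_of_mul_le_mul_right (le_trans ?_ hmain) h1φ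
  rw [← abs_of_pos h1φ, ← abs_mul, mul_comm, mul_neg_geom_sum]
  have : |φ ^ M| ≤ 1 := by rw [abs_pow]; exact pow_le_one₀ (abs_nonneg _) hφ1
  exact (abs_sub _ _).trans (by rw [abs_one]; linarith)

/-! ### Finiteness of the Green function and transience -/

/-- The Green kernel has an integrable majorant. -/
lemma lintegral_sum_pow_integral_cos_lt_top {Ω : Type*} [MeasurableSpace Ω] {μ : Measure Ω}
    [IsProbabilityMeasure μ] {X : Ω → ℤ} (hX : Measurable X) {p : ℕ → ℝ}
    (hp : ∀ n : ℕ, μ.real {ω | X ω = ((n + 1 : ℕ) : ℤ)} = p (n + 1))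
    (hpos : ∀ n : ℕ, 0 < p (n + 1))
    (hsum : Summable fun n : ℕ => 1 / (((n + 1 : ℕ) : ℝ) ^ 3 * p (n + 1))) :
    ∃ K : ENNReal, K < ⊤ ∧ ∀ M : ℕ, ∫⁻ t in Set.Ioc (-Real.pi) Real.pi,
      ‖∑ m ∈ Finset.range M, (∫ ω, Real.cos (t * X ω) ∂μ) ^ m‖ₑ ≤ K := by
  -- n + 1 ≤ π/|t| means |t| ≤ `a n`. Bounding t⁴ by `a n ^ 4` on that interval makes each term of
  -- the majorant a step function.
  let a : ℕ → ℝ := fun n => Real.pi / ((n + 1 : ℕ) : ℝ)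
  let c : ℕ → ℝ := fun n => 9 * Real.pi ^ 2 * a n ^ 4 * (((n + 1 : ℕ) : ℝ) ^ 2 / p (n + 1))
  let G : ℕ → ℝ → ENNReal := fun n =>
    Set.indicator (Set.Icc (-a n) (a n)) fun _ => ENNReal.ofReal (c n)
  refine ⟨∫⁻ t, ∑' n, G n t, ?_, fun M => ?_⟩
  · rw [lintegral_tsum fun n => (measurable_const.indicator measurableSet_Icc).aemeasurable]
    have hG : ∀ n, ∫⁻ t, G n t =
        ENNReal.ofReal (18 * Real.pi ^ 7 * (1 / (((n + 1 : ℕ) : ℝ) ^ 3 * p (n + 1)))) := fun n => by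
      have hn : (0 : ℝ) < ((n + 1 : ℕ) : ℝ) := by positivity
      have hpn := hpos n
      rw [lintegral_indicator_const measurableSet_Icc, Real.volume_Icc,
        ← ENNReal.ofReal_mul (by positivity)]
      congr 1
      simp only [c, a]
      field_simp
      ring
    rw [tsum_congr hG]
    exact (hsum.mul_left _).tsum_ofReal_lt_top
  · refine le_trans (lintegral_mono_ae ?_) (setLIntegral_le_lintegral _ _)
    filter_upwards [ae_restrict_mem measurableSet_Ioc,
      ae_restrict_of_ae (Measure.ae_ne volume (0 : ℝ))] with t ht ht0
    have htp : 0 < |t| := abs_pos.mpr ht0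
    have hb := abs_sum_pow_integral_cos_le hX hp hpos ht0 (abs_le.mpr ⟨ht.1.le, ht.2⟩) M
    rw [Real.enorm_eq_ofReal_abs]
    refine (ENNReal.ofReal_le_ofReal hb).trans ?_
    rw [ENNReal.ofReal_sum_of_nonneg fun n _ =>
      mul_nonneg (by positivity) (div_nonneg (sq_nonneg _) (hpos n).le)]
    refine le_trans (Finset.sum_le_sum fun n hn => ?_) (ENNReal.sum_le_tsum _)
    have hta : |t| ≤ a n := by
      have h1 : ((n + 1 : ℕ) : ℝ) ≤ Real.pi / |t| :=
        (Nat.le_floor_iff (by positivity)).mp (Finset.mem_range.mp hn)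
      rw [le_div_iff₀ htp] at h1
      rw [le_div_iff₀ (by positivity)]
      linarith
    simp only [G]
    rw [Set.indicator_of_mem (by exact abs_le.mp hta)]
    refine ENNReal.ofReal_le_ofReal ?_
    have hpn := hpos n
    have h4 : t ^ 4 ≤ a n ^ 4 := by
      rw [← Even.pow_abs (by decide) t]
      gcongr
    simp only [c]
    gcongr

/-- The Green function of the walk is finite. -/
lemma tsum_measure_walk_eq_lt_top {Ω : Type*} [MeasurableSpace Ω] {μ : Measure Ω}
    [IsProbabilityMeasure μ] {J : ℕ → Ω → ℤ} (hJ : IsIIDJumps μ J)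
    (hsymm : IdentDistrib (J 0) (fun ω => -J 0 ω) μ μ) {p : ℕ → ℝ}
    (hp : ∀ n : ℕ, μ.real {ω | J 0 ω = ((n + 1 : ℕ) : ℤ)} = p (n + 1))
    (hpos : ∀ n : ℕ, 0 < p (n + 1))
    (hsum : Summable fun n : ℕ => 1 / (((n + 1 : ℕ) : ℝ) ^ 3 * p (n + 1))) (u : ℤ) :
    ∑' n, μ {ω | walk J n ω = u} < ⊤ := by
  obtain ⟨K, hK, hbound⟩ := lintegral_sum_pow_integral_cos_lt_top (hJ.measurable 0) hp hpos hsum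
  refine lt_of_le_of_lt (ENNReal.tsum_le_of_sum_range_le fun M => ?_) hK
  have hW : ∀ n, Measurable (walk J n) := fun n =>
    Finset.measurable_sum _ fun i _ => hJ.measurable i
  have hmeas : Measurable fun t : ℝ => ∫ ω, Real.cos (t * J 0 ω) ∂μ := by
    have hm : Measurable fun ω => (J 0 ω : ℝ) :=
      (measurable_from_top (f := fun k : ℤ => (k : ℝ))).comp (hJ.measurable 0)
    have : StronglyMeasurable (Function.uncurry fun (t : ℝ) ω => Real.cos (t * J 0 ω)) :=
      (Real.measurable_cos.comp (measurable_fst.mul (hm.comp measurable_snd))).stronglyMeasurable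
    exact this.integral_prod_right.measurable
  have hint : ∀ n, IntegrableOn
      (fun t : ℝ => Real.cos (t * u) * (∫ ω, Real.cos (t * J 0 ω) ∂μ) ^ n)
      (Set.Ioc (-Real.pi) Real.pi) := fun n => by
    refine Integrable.of_bound (C := 1) (by fun_prop) (ae_of_all _ fun t => ?_)
    have h1 : |∫ ω, Real.cos (t * J 0 ω) ∂μ| ≤ 1 := by
      have := norm_integral_le_of_norm_le_const (μ := μ) (f := fun ω => Real.cos (t * J 0 ω))
        (C := 1) (ae_of_all _ fun ω => Real.abs_cos_le_one _)
      simpa using this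
    rw [Real.norm_eq_abs, abs_mul, abs_pow]
    exact mul_le_one₀ (Real.abs_cos_le_one _) (by positivity) (pow_le_one₀ (abs_nonneg _) h1)
  have hprob : ∀ n, 2 * Real.pi * μ.real {ω | walk J n ω = u} =
      ∫ t in Set.Ioc (-Real.pi) Real.pi,
        Real.cos (t * u) * (∫ ω, Real.cos (t * J 0 ω) ∂μ) ^ n := fun n => by
    have := two_pi_mul_measureReal_eq (μ := μ) (X := fun ω => walk J n ω - u)
      ((hW n).sub_const u)
    simp only [integral_cos_walk hJ hsymm, sub_eq_zero] at this
    exact this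
  have hsumeq : 2 * Real.pi * ∑ n ∈ Finset.range M, μ.real {ω | walk J n ω = u} =
      ∫ t in Set.Ioc (-Real.pi) Real.pi,
        Real.cos (t * u) * ∑ n ∈ Finset.range M, (∫ ω, Real.cos (t * J 0 ω) ∂μ) ^ n := by
    simp only [Finset.mul_sum, hprob]
    rw [integral_finsetSum _ fun n _ => hint n]
  calc ∑ n ∈ Finset.range M, μ {ω | walk J n ω = u}
      = ENNReal.ofReal (∑ n ∈ Finset.range M, μ.real {ω | walk J n ω = u}) := by
        rw [ENNReal.ofReal_sum_of_nonneg fun _ _ => measureReal_nonneg]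
        simp
    _ ≤ ENNReal.ofReal (2 * Real.pi * ∑ n ∈ Finset.range M, μ.real {ω | walk J n ω = u}) := by
        refine ENNReal.ofReal_le_ofReal (le_mul_of_one_le_left
          (Finset.sum_nonneg fun _ _ => measureReal_nonneg) (by linarith [Real.pi_gt_three]))
    _ ≤ ‖∫ t in Set.Ioc (-Real.pi) Real.pi, Real.cos (t * u) *
          ∑ n ∈ Finset.range M, (∫ ω, Real.cos (t * J 0 ω) ∂μ) ^ n‖ₑ := by
        rw [hsumeq, Real.enorm_eq_ofReal_abs]
        exact ENNReal.ofReal_le_ofReal (le_abs_self _)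
    _ ≤ ∫⁻ t in Set.Ioc (-Real.pi) Real.pi, ‖Real.cos (t * u) *
          ∑ n ∈ Finset.range M, (∫ ω, Real.cos (t * J 0 ω) ∂μ) ^ n‖ₑ :=
        enorm_integral_le_lintegral_enorm _
    _ ≤ ∫⁻ t in Set.Ioc (-Real.pi) Real.pi,
          ‖∑ n ∈ Finset.range M, (∫ ω, Real.cos (t * J 0 ω) ∂μ) ^ n‖ₑ := by
        refine lintegral_mono fun t => ?_
        rw [Real.enorm_eq_ofReal_abs, Real.enorm_eq_ofReal_abs, abs_mul]
        exact ENNReal.ofReal_le_ofReal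
          (mul_le_of_le_one_left (abs_nonneg _) (Real.abs_cos_le_one _))
    _ ≤ K := hbound M

/-- A process that visits every state finitely often in mean escapes to infinity. -/
lemma isTransient_of_tsum_measure_eq_lt_top {Ω : Type*} [MeasurableSpace Ω] {μ : Measure Ω}
    {X : ℕ → Ω → ℤ} (h : ∀ u : ℤ, ∑' n, μ {ω | X n ω = u} < ⊤) : IsTransient μ X := by
  have hev : ∀ᵐ ω ∂μ, ∀ u : ℤ, ∀ᶠ n in atTop, ω ∉ {ω | X n ω = u} :=
    ae_all_iff.mpr fun u => ae_eventually_notMem (h u).ne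
  filter_upwards [hev] with ω hω
  refine tendsto_atTop.mpr fun b => ?_
  filter_upwards [(Filter.eventually_all_finset (Finset.Ioo (-b) b)).mpr fun u _ => hω u] with n hn
  by_contra! hlt
  exact hn (X n ω) (Finset.mem_Ioo.mpr (abs_lt.mp hlt)) rfl

end RW

theorem theorem2p1 {Ω : Type*} [MeasurableSpace Ω] (μ : Measure Ω) [IsProbabilityMeasure μ]
    (J : ℕ → Ω → ℤ) (hJ : RW.IsIIDJumps μ J)
    (hsymm : RW.IsSymmetricProcess μ (RW.walk J))
    (p : ℕ → ℝ) (hp : ∀ n : ℕ, 1 ≤ n → μ.real {ω | J 0 ω = (n : ℤ)} = p n)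
    (hpos : ∀ n : ℕ, 1 ≤ n → 0 < p n)
    (hsum : Summable fun n : ℕ => 1 / (((n + 1 : ℕ) : ℝ) ^ 3 * p (n + 1))) :
    RW.IsTransient μ (RW.walk J) ∧ RW.AllStatesTransient μ (RW.walk J) := by
  -- The walk at time 1 is the first jump.
  have hs : IdentDistrib (J 0) (fun ω => -J 0 ω) μ μ := by
    have h := (hsymm {1}).comp
      (measurable_pi_apply (⟨1, Finset.mem_singleton_self 1⟩ : ({1} : Finset ℕ)))
    simpa [Function.comp_def, RW.walk] using h
  have hfin := RW.tsum_measure_walk_eq_lt_top hJ hs (fun n => hp (n + 1) n.succ_pos)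
    (fun n => hpos (n + 1) n.succ_pos) hsum
  refine ⟨RW.isTransient_of_tsum_measure_eq_lt_top hfin, fun u => ?_⟩
  simp only [add_eq_left]
  -- Dropping time 0 leaves a subseries of the Green function at 0.
  exact (ENNReal.tsum_comp_le_tsum_of_injective (add_left_injective 1)
    fun n => μ {ω | RW.walk J n ω = 0}).trans_lt (hfin 0)
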